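/- Let $k$ be a field of characteristic $0$ and let $(\mathfrak g,\triangleleft,\mathfrak a)$ be a right Lie module over $k$: $\mathfrak g,\mathfrak a$ are Lie algebras and $\triangleleft$ is a bilinear right action of $\mathfrak a$ on $\mathfrak g$ by derivations, i.e. $[x,y]\triangleleft a=[x\triangleleft a,y]+[x,y\triangleleft a]$ and $x\triangleleft[a,b]=(x\triangleleft a)\triangleleft b-(x\triangleleft b)\triangleleft a$. Extend $\triangleleft$ to the right action $\blacktriangleleft$ of the Hopf algebra $K=\mathcal U(\mathfrak a)$ on the Hopf algebra $H=\mathcal U(\mathfrak g)$ for which $a\in\mathfrak a$ acts by the derivation $x_1\cdots x_n\mapsto\sum_i x_1\cdots(x_i\triangleleft a)\cdots x_n$. An $\mathcal O$-Hopf operator is a coalgebra map $T:H\to K$ with $T(e)\,T(f)=T\big((e\blacktriangleleft T(f_{(1)}))f_{(2)}\big)$ for all $e,f\in H$ (Sweedler notation). For linear maps $A,B:H\to K$ let $(A*B)(f)=A(f_{(1)})B(f_{(2)})$ be the convolution product and $$(A\# B)(f)=A\Big(f_{(1)}\blacktriangleleft S_K\big(B(f_{(2)})_{(1)}\big)\Big)\,B(f_{(2)})_{(2)},$$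 an associative product with unit $\eta_K\circ\varepsilon_H$. Let $\delta$ be the space of linear maps $\alpha:H\to K$ with $\Delta\circ\alpha=(\eta_K\varepsilon_H\otimes\alpha+\alpha\otimes\eta_K\varepsilon_H)\circ\Delta$, and let $\exp_\#(\alpha)=\eta_K\circ\varepsilon_H+\sum_{n\ge1}\frac1{n!}\alpha^{\# n}$ (pointwise, when the sum is finite on every element). Let $\mathrm{sol}_n:H\to H$ be the Eulerian idempotents: $\mathrm{sol}_1=\log_*(\mathrm{id})=\sum_{n\ge1}\frac{(-1)^{n-1}}{n}(\mathrm{id}-\eta_H\varepsilon_H)^{*n}$ and $\mathrm{sol}_n=\frac1{n!}\mathrm{sol}_1^{*n}$ (convolution powers in $\mathrm{End}(H)$), so that $\mathrm{sol}_n$ is the projection of $\mathcal U(\mathfrak g)$ onto the symmetrization of $S^n(\mathfrak g)$ along those of $S^m(\mathfrak g)$, $m\ne n$. **Theorem.** Let $T:\mathcal U(\mathfrak g)\to\mathcal U(\mathfrak a)$ be an $\mathcal O$-Hopf operator and put $\Gamma_n=T\circ\mathrm{sol}_n$ for $n\ge1$. Then for all $n\ge 1$ and $f\in\mathcal U(\mathfrak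 g)$ $$\Gamma_{n+1}(f)=\frac1{n+1}\Big((\Gamma_n*\Gamma_1)(f)-\Gamma_n\big(f_{(1)}\blacktriangleleft\Gamma_1(f_{(2)})\big)\Big),\qquad \Gamma_n=\frac1{n!}\,\Gamma_1^{\# n}.$$ Moreover $\Gamma_1=T\circ\mathrm{sol}_1$ lies in $\delta$, for every $f$ one has $\Gamma_1^{\# n}(f)=0$ for all large $n$, and $$T=\exp_\#(T\circ\mathrm{sol}_1).$$ -/

import Mathlib

open scoped TensorProduct
open Coalgebra WithConv

noncomputable section

/-! ### The Hopf algebra structure of the universal enveloping algebra -/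

namespace UniversalEnvelopingAlgebra

attribute [local instance] LieRing.ofAssociativeRing

variable (R : Type*) {L : Type*} [CommRing R] [LieRing L] [LieAlgebra R L]

/-- Algebra morphisms that agree on `L` are equal. -/
theorem algHom_ext {A : Type*} [Ring A] [Algebra R A] {f g : UniversalEnvelopingAlgebra R L →ₐ[R] A}
    (h : ∀ x : L, f (ι R x) = g (ι R x)) : f = g :=
  hom_ext R (LieHom.ext h)

/-- The enveloping algebra is generated by the image of `L`. -/
theorem adjoin_range_ι : Algebra.adjoin R (Set.range (ι R : L → UniversalEnvelopingAlgebra R L)) = ⊤ := by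
  set S := Algebra.adjoin R (Set.range (ι R : L → UniversalEnvelopingAlgebra R L)) with hS
  have hmem : ∀ x : L, ι R x ∈ S := fun x => Algebra.subset_adjoin ⟨x, rfl⟩
  let f : L →ₗ⁅R⁆ S :=
    { toFun := fun x => ⟨ι R x, hmem x⟩
      map_add' := fun x y => Subtype.ext (by simp)
      map_smul' := fun c x => Subtype.ext (by simp)
      map_lie' := fun {x y} => Subtype.ext (by
        rw [LieRing.of_associative_ring_bracket]
        exact (LieHom.map_lie (ι R) x y).trans (LieRing.of_associative_ring_bracket _ _)) }
  have h : S.val.comp (lift R f) = AlgHom.id R _ := by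
    refine algHom_ext R fun x => ?_
    simp [-ι_apply, lift_ι_apply, f]
  refine eq_top_iff.2 fun u _ => ?_
  have := congrArg (fun φ : _ →ₐ[R] _ => φ u) h
  simp only [AlgHom.comp_apply, AlgHom.id_apply] at this
  rw [← this]
  exact (lift R f u).2

variable {R}

/-- Induction over products of elements of `L`. -/
theorem left_induction {p : Submodule R (UniversalEnvelopingAlgebra R L)} (h1 : 1 ∈ p)
    (hmul : ∀ (x : L) (u), u ∈ p → ι R x * u ∈ p) (u : UniversalEnvelopingAlgebra R L) : u ∈ p := by
  have key : ∀ v ∈ Algebra.adjoin R (Set.range (ι R : L → UniversalEnvelopingAlgebra R L)),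
      ∀ w ∈ p, v * w ∈ p := by
    intro v hv
    induction hv using Algebra.adjoin_induction with
    | mem x hx => obtain ⟨x, rfl⟩ := hx; exact hmul x
    | algebraMap r => intro w hw; rw [← Algebra.smul_def]; exact p.smul_mem _ hw
    | add x y _ _ hx hy => intro w hw; rw [add_mul]; exact p.add_mem (hx w hw) (hy w hw)
    | mul x y _ _ hx hy => intro w hw; rw [mul_assoc]; exact hx _ (hy w hw)
  simpa using key u (by rw [adjoin_range_ι]; trivial) 1 h1

theorem ι_mul_sub (x y : L) : ι R x * ι R y - ι R y * ι R x = ι R ⁅x, y⁆ := by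
  rw [LieHom.map_lie, LieRing.of_associative_ring_bracket]

variable (R L)

/-- The coproduct: the algebra morphism with `Δ x = x ⊗ 1 + 1 ⊗ x` for `x ∈ L`. -/
def comulHom : UniversalEnvelopingAlgebra R L →ₐ[R]
    UniversalEnvelopingAlgebra R L ⊗[R] UniversalEnvelopingAlgebra R L :=
  lift R
    { toFun := fun x => ι R x ⊗ₜ[R] 1 + 1 ⊗ₜ[R] ι R x
      map_add' := fun x y => by
        simp only [map_add, TensorProduct.add_tmul, TensorProduct.tmul_add]; abel
      map_smul' := fun c x => by
        simp [TensorProduct.smul_tmul']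
      map_lie' := fun {x y} => by
        rw [LieRing.of_associative_ring_bracket, ← ι_mul_sub]
        simp only [mul_add, add_mul, Algebra.TensorProduct.tmul_mul_tmul, one_mul, mul_one,
          TensorProduct.sub_tmul, TensorProduct.tmul_sub]
        abel }

/-- The counit: the algebra morphism vanishing on `L`. -/
def counitHom : UniversalEnvelopingAlgebra R L →ₐ[R] R := lift R 0

/-- The antipode as an algebra morphism to the opposite algebra: `x ↦ -x` for `x ∈ L`. -/
def antipodeHom : UniversalEnvelopingAlgebra R L →ₐ[R] (UniversalEnvelopingAlgebra R L)ᵐᵒᵖ :=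
  lift R
    { toFun := fun x => MulOpposite.op (-ι R x)
      map_add' := fun x y => by
        rw [← MulOpposite.op_add, map_add, neg_add]
      map_smul' := fun c x => by
        simp
      map_lie' := fun {x y} => by
        rw [LieRing.of_associative_ring_bracket, ← ι_mul_sub, ← MulOpposite.op_mul,
          ← MulOpposite.op_mul, ← MulOpposite.op_sub]
        congr 1
        simp }

variable {L}

@[simp] theorem comulHom_ι (x : L) :
    comulHom R L (ι R x) = ι R x ⊗ₜ[R] 1 + 1 ⊗ₜ[R] ι R x := lift_ι_apply R _ x

@[simp] theorem counitHom_ι (x : L) : counitHom R L (ι R x) = 0 := lift_ι_apply R _ x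

@[simp] theorem antipodeHom_ι (x : L) :
    antipodeHom R L (ι R x) = MulOpposite.op (-ι R x) := lift_ι_apply R _ x

variable (L)

instance instBialgebra : Bialgebra R (UniversalEnvelopingAlgebra R L) :=
  Bialgebra.ofAlgHom (comulHom R L) (counitHom R L)
    (by
      refine algHom_ext R fun x => ?_
      simp [-ι_apply, Algebra.TensorProduct.one_def, TensorProduct.add_tmul,
        TensorProduct.tmul_add]
      abel)
    (by refine algHom_ext R fun x => ?_; simp [-ι_apply])
    (by refine algHom_ext R fun x => ?_; simp [-ι_apply])

variable {L}

@[simp] theorem comul_ι (x : L) :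
    comul (R := R) (ι R x) = ι R x ⊗ₜ[R] 1 + 1 ⊗ₜ[R] ι R x := comulHom_ι R x

@[simp] theorem counit_ι (x : L) : counit (R := R) (ι R x) = 0 := counitHom_ι R x

variable (L)

instance instIsCocomm : IsCocomm R (UniversalEnvelopingAlgebra R L) where
  comm_comp_comul := by
    have h : (Algebra.TensorProduct.comm R (UniversalEnvelopingAlgebra R L)
          (UniversalEnvelopingAlgebra R L)).toAlgHom.comp (Bialgebra.comulAlgHom R _) =
        Bialgebra.comulAlgHom R (UniversalEnvelopingAlgebra R L) := by
      refine algHom_ext R fun x => ?_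
      simp [-ι_apply]
      abel
    exact congr(($h).toLinearMap)

/-- The antipode as a linear map. -/
def antipodeMap : UniversalEnvelopingAlgebra R L →ₗ[R] UniversalEnvelopingAlgebra R L :=
  (MulOpposite.opLinearEquiv R).symm.toLinearMap ∘ₗ (antipodeHom R L).toLinearMap

variable {L}

@[simp] theorem antipodeMap_one : antipodeMap R L 1 = 1 := by simp [antipodeMap]

@[simp] theorem antipodeMap_ι (x : L) : antipodeMap R L (ι R x) = -ι R x := by
  simp [antipodeMap, -ι_apply]

theorem antipodeMap_mul (u v : UniversalEnvelopingAlgebra R L) :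
    antipodeMap R L (u * v) = antipodeMap R L v * antipodeMap R L u := by simp [antipodeMap]

theorem antipode_aux_right (x : L)
    (t : UniversalEnvelopingAlgebra R L ⊗[R] UniversalEnvelopingAlgebra R L) :
    LinearMap.mul' R _ ((antipodeMap R L).rTensor _
      ((ι R x ⊗ₜ[R] 1 + 1 ⊗ₜ[R] ι R x) * t)) = 0 := by
  induction t using TensorProduct.induction_on with
  | zero => simp
  | tmul a b => simp [-ι_apply, add_mul, antipodeMap_mul, mul_assoc]
  | add s t hs ht => rw [mul_add, map_add, map_add, hs, ht, add_zero]

theorem antipode_aux_left (x : L)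
    (t : UniversalEnvelopingAlgebra R L ⊗[R] UniversalEnvelopingAlgebra R L) :
    LinearMap.mul' R _ ((antipodeMap R L).lTensor _
      ((ι R x ⊗ₜ[R] 1 + 1 ⊗ₜ[R] ι R x) * t)) =
    ι R x * LinearMap.mul' R _ ((antipodeMap R L).lTensor _ t) -
      LinearMap.mul' R _ ((antipodeMap R L).lTensor _ t) * ι R x := by
  induction t using TensorProduct.induction_on with
  | zero => simp
  | tmul a b => simp [-ι_apply, add_mul, antipodeMap_mul, mul_assoc, sub_eq_add_neg]
  | add s t hs ht =>
    rw [mul_add, map_add, map_add, hs, ht, map_add, map_add, mul_add, add_mul]; abel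

variable (L)

instance instHopfAlgebra : HopfAlgebra R (UniversalEnvelopingAlgebra R L) where
  antipode := antipodeMap R L
  mul_antipode_rTensor_comul := by
    refine LinearMap.ext fun u => ?_
    refine left_induction (p := LinearMap.eqLocus
      (LinearMap.mul' R _ ∘ₗ (antipodeMap R L).rTensor _ ∘ₗ comul)
      (Algebra.linearMap R _ ∘ₗ counit)) ?_ (fun x v _ => ?_) u
    · simp [LinearMap.mem_eqLocus, Algebra.TensorProduct.one_def]
    · rw [LinearMap.mem_eqLocus]
      simp only [LinearMap.comp_apply, Bialgebra.comul_mul, comul_ι, Bialgebra.counit_mul,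
        counit_ι, zero_mul, map_zero]
      exact antipode_aux_right R x _
  mul_antipode_lTensor_comul := by
    refine LinearMap.ext fun u => ?_
    refine left_induction (p := LinearMap.eqLocus
      (LinearMap.mul' R _ ∘ₗ (antipodeMap R L).lTensor _ ∘ₗ comul)
      (Algebra.linearMap R _ ∘ₗ counit)) ?_ (fun x v hv => ?_) u
    · simp [LinearMap.mem_eqLocus, Algebra.TensorProduct.one_def]
    · rw [LinearMap.mem_eqLocus] at hv ⊢
      simp only [LinearMap.comp_apply, Bialgebra.comul_mul, comul_ι, Bialgebra.counit_mul,
        counit_ι, zero_mul, map_zero] at hv ⊢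
      rw [antipode_aux_left, hv, Algebra.linearMap_apply, Algebra.commutes, sub_self]

end UniversalEnvelopingAlgebra

/-! ### Lie modules, Hopf modules and `𝒪`-Hopf operators -/

/-- A right Lie module `(𝔤, ◁, 𝔞)`: the Lie algebra `𝔞` acts from the right on the Lie algebra `𝔤`
by derivations. Here `act x a` is `x ◁ a`. -/
structure RightLieModule (k 𝔤 𝔞 : Type*) [CommRing k] [LieRing 𝔤] [LieAlgebra k 𝔤]
    [LieRing 𝔞] [LieAlgebra k 𝔞] where
  act : 𝔤 →ₗ[k] 𝔞 →ₗ[k] 𝔤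
  lie_act : ∀ x y a, act ⁅x, y⁆ a = ⁅act x a, y⁆ + ⁅x, act y a⁆
  act_lie : ∀ x a b, act x ⁅a, b⁆ = act (act x a) b - act (act x b) a

/-- A right Hopf module `(H, ◁◁, K)`: the cocommutative Hopf algebra `K` acts from the right on the
cocommutative Hopf algebra `H`, compatibly with products, coproducts and antipodes. Here `act h a`
is `h ◁◁ a`. -/
structure RightHopfModule (k H K : Type*) [CommRing k] [Ring H] [Ring K] [HopfAlgebra k H]
    [HopfAlgebra k K] [IsCocomm k H] [IsCocomm k K] where
  act : H →ₗ[k] K →ₗ[k] H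
  act_one : ∀ h, act h 1 = h
  act_mul : ∀ h a b, act h (a * b) = act (act h a) b
  one_act : ∀ a, act 1 a = algebraMap k H (counit a)
  mul_act : ∀ h₁ h₂ a, act (h₁ * h₂) a =
    LinearMap.mul' k H (TensorProduct.map (act h₁) (act h₂) (comul a))
  counit_act : ∀ h a, counit (R := k) (act h a) = counit (R := k) h * counit (R := k) a
  comul_act : ∀ h a, comul (R := k) (act h a) =
    TensorProduct.map₂ act act (comul (R := k) h) (comul (R := k) a)
  antipode_act : ∀ h a, HopfAlgebra.antipode k (act h a) = act (HopfAlgebra.antipode k h) a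

namespace RightHopfModule

variable {k H K : Type*} [CommRing k] [Ring H] [Ring K] [HopfAlgebra k H] [HopfAlgebra k K]
  [IsCocomm k H] [IsCocomm k K] (M : RightHopfModule k H K)

/-- A coalgebra map `T : H → K` is an `𝒪`-Hopf operator if
`T(e) T(f) = T((e ◁◁ T(f₍₁₎)) f₍₂₎)` for all `e, f`. -/
def IsOHopfOperator (T : H →ₗc[k] K) : Prop :=
  ∀ e f : H, T e * T f =
    T (LinearMap.mul' k H
      (TensorProduct.map (M.act e ∘ₗ (T : H →ₗ[k] K)) LinearMap.id (comul (R := k) f)))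

/-- The linear map `id ◁◁ B : f ↦ f₍₁₎ ◁◁ B(f₍₂₎)`. -/
def idAct (B : H →ₗ[k] K) : H →ₗ[k] H :=
  TensorProduct.lift M.act ∘ₗ TensorProduct.map LinearMap.id B ∘ₗ comul

/-- The product `(A # B)(f) = A(f₍₁₎ ◁◁ S(B(f₍₂₎)₍₁₎)) B(f₍₂₎)₍₂₎` of linear maps `H → K`. -/
def hash (A B : H →ₗ[k] K) : H →ₗ[k] K :=
  LinearMap.mul' k K ∘ₗ
    TensorProduct.map (A ∘ₗ TensorProduct.lift M.act) LinearMap.id ∘ₗ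
    (TensorProduct.assoc k H K K).symm.toLinearMap ∘ₗ
    TensorProduct.map LinearMap.id
      (TensorProduct.map (HopfAlgebra.antipode k) LinearMap.id ∘ₗ comul ∘ₗ B) ∘ₗ
    comul

/-- Powers `A^{# n}` for the product `#`; `A^{# 0}` is the unit `η ∘ ε`. -/
def hashPow (A : H →ₗ[k] K) : ℕ → (H →ₗ[k] K)
  | 0 => Algebra.linearMap k K ∘ₗ counit
  | n + 1 => M.hash (hashPow A n) A

/-- The space `δ` of `ε`-cococycles `H → K`:
`Δ ∘ α = (η ∘ ε ⊗ α + α ⊗ η ∘ ε) ∘ Δ`. -/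
def IsCococycle (α : H →ₗ[k] K) : Prop :=
  comul ∘ₗ α = (TensorProduct.map (Algebra.linearMap k K ∘ₗ counit) α +
    TensorProduct.map α (Algebra.linearMap k K ∘ₗ counit)) ∘ₗ comul

end RightHopfModule

/-- The exponential `exp_#(α) = η ∘ ε + ∑_{n ≥ 1} α^{# n} / n!`, evaluated pointwise. It is meant for
`α` such that `α^{# n}(f) = 0` for all large `n` (depending on `f`). -/
def RightHopfModule.expHash {k H K : Type*} [Field k] [Ring H] [Ring K] [HopfAlgebra k H]
    [HopfAlgebra k K] [IsCocomm k H] [IsCocomm k K] (M : RightHopfModule k H K)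
    (α : H →ₗ[k] K) (f : H) : K :=
  ∑ᶠ n : ℕ, (n.factorial : k)⁻¹ • M.hashPow α n f

/-! ### The envelope of a right Lie module -/

namespace RightLieModule

open UniversalEnvelopingAlgebra

attribute [local instance] LieRing.ofAssociativeRing

variable {k 𝔤 𝔞 : Type*} [CommRing k] [LieRing 𝔤] [LieAlgebra k 𝔤] [LieRing 𝔞] [LieAlgebra k 𝔞]
  (M : RightLieModule k 𝔤 𝔞)

/-- The algebra morphism `u ↦ u + ϵ (u ◁◁ a)`, `ϵ² = 0`, for `a ∈ 𝔞`. -/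
def dualHom (a : 𝔞) : UniversalEnvelopingAlgebra k 𝔤 →ₐ[k]
    TrivSqZeroExt (UniversalEnvelopingAlgebra k 𝔤) (UniversalEnvelopingAlgebra k 𝔤) :=
  lift k
    { toFun := fun x => TrivSqZeroExt.inl (ι k x) + TrivSqZeroExt.inr (ι k (M.act x a))
      map_add' := fun x y => by
        ext <;> simp [-ι_apply]
      map_smul' := fun c x => by
        ext <;> simp [-ι_apply]
      map_lie' := fun {x y} => by
        rw [LieRing.of_associative_ring_bracket, M.lie_act, map_add]
        simp only [← ι_mul_sub]
        ext <;> simp [-ι_apply]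
        abel }

@[simp] theorem fst_dualHom (a : 𝔞) (u : UniversalEnvelopingAlgebra k 𝔤) :
    (M.dualHom a u).fst = u := by
  have : (TrivSqZeroExt.fstHom k _ _).comp (M.dualHom a) = AlgHom.id k _ :=
    algHom_ext k fun x => by
      simp [dualHom, -ι_apply, lift_ι_apply]
  exact congrArg (fun φ : _ →ₐ[k] _ => φ u) this

/-- The derivation `x₁ ⋯ xₙ ↦ ∑ᵢ x₁ ⋯ (xᵢ ◁ a) ⋯ xₙ` of the enveloping algebra of `𝔤`. -/
def derAct (a : 𝔞) : UniversalEnvelopingAlgebra k 𝔤 →ₗ[k] UniversalEnvelopingAlgebra k 𝔤 where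
  toFun u := (M.dualHom a u).snd
  map_add' u v := by simp
  map_smul' c u := by simp

@[simp] theorem derAct_ι (a : 𝔞) (x : 𝔤) : M.derAct a (ι k x) = ι k (M.act x a) := by
  simp [derAct, dualHom, -ι_apply, lift_ι_apply]

@[simp] theorem derAct_one (a : 𝔞) : M.derAct a 1 = 0 := by
  simp [derAct]

theorem derAct_mul (a : 𝔞) (u v : UniversalEnvelopingAlgebra k 𝔤) :
    M.derAct a (u * v) = M.derAct a u * v + u * M.derAct a v := by
  simp [derAct, add_comm]

/-- The right action of the enveloping algebra of `𝔞` on that of `𝔤`, as an algebra morphism to the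
opposite of the algebra of linear endomorphisms, extending `a ↦ derAct a`. -/
def actHom : UniversalEnvelopingAlgebra k 𝔞 →ₐ[k]
    (Module.End k (UniversalEnvelopingAlgebra k 𝔤))ᵐᵒᵖ :=
  lift k
    { toFun := fun a => MulOpposite.op (M.derAct a)
      map_add' := fun a b => by
        rw [← MulOpposite.op_add]
        congr 1
        refine LinearMap.ext fun u => left_induction
          (p := LinearMap.eqLocus (M.derAct (a + b)) (M.derAct a + M.derAct b)) ?_ ?_ u
        · simp [LinearMap.mem_eqLocus]
        · intro x v hv
          rw [LinearMap.mem_eqLocus] at hv ⊢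
          simp only [LinearMap.add_apply, derAct_mul, derAct_ι, map_add, hv, add_mul, mul_add]
          abel
      map_smul' := fun c a => by
        rw [RingHom.id_apply, ← MulOpposite.op_smul]
        congr 1
        refine LinearMap.ext fun u => left_induction
          (p := LinearMap.eqLocus (M.derAct (c • a)) (c • M.derAct a)) ?_ ?_ u
        · simp [LinearMap.mem_eqLocus]
        · intro x v hv
          rw [LinearMap.mem_eqLocus] at hv ⊢
          simp only [LinearMap.smul_apply, derAct_mul, derAct_ι, map_smul, hv, smul_add,
            smul_mul_assoc, mul_smul_comm]
      map_lie' := fun {a b} => by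
        rw [LieRing.of_associative_ring_bracket, ← MulOpposite.op_mul, ← MulOpposite.op_mul,
          ← MulOpposite.op_sub]
        congr 1
        refine LinearMap.ext fun u => left_induction
          (p := LinearMap.eqLocus (M.derAct ⁅a, b⁆)
            (M.derAct b * M.derAct a - M.derAct a * M.derAct b)) ?_ ?_ u
        · simp [LinearMap.mem_eqLocus]
        · intro x v hv
          rw [LinearMap.mem_eqLocus] at hv ⊢
          simp only [LinearMap.sub_apply, Module.End.mul_apply, derAct_mul, derAct_ι, map_add,
            M.act_lie, map_sub, hv, sub_mul, mul_sub]
          abel }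

/-- The right action `u ◁◁ A` of the enveloping algebra of `𝔞` on that of `𝔤`. -/
def envAct : UniversalEnvelopingAlgebra k 𝔤 →ₗ[k] UniversalEnvelopingAlgebra k 𝔞 →ₗ[k]
    UniversalEnvelopingAlgebra k 𝔤 :=
  ((MulOpposite.opLinearEquiv k).symm.toLinearMap ∘ₗ M.actHom.toLinearMap).flip

theorem envAct_one (u : UniversalEnvelopingAlgebra k 𝔤) : M.envAct u 1 = u := by
  simp [envAct]

theorem envAct_mul (u : UniversalEnvelopingAlgebra k 𝔤) (a b : UniversalEnvelopingAlgebra k 𝔞) :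
    M.envAct u (a * b) = M.envAct (M.envAct u a) b := by
  simp [envAct]

theorem envAct_ι (u : UniversalEnvelopingAlgebra k 𝔤) (a : 𝔞) :
    M.envAct u (ι k a) = M.derAct a u := by
  simp [envAct, actHom, -ι_apply, lift_ι_apply]

theorem envAct_ι_mul (u : UniversalEnvelopingAlgebra k 𝔤) (a : 𝔞)
    (b : UniversalEnvelopingAlgebra k 𝔞) :
    M.envAct u (ι k a * b) = M.envAct (M.derAct a u) b := by
  rw [envAct_mul, envAct_ι]

theorem envAct_one_left (a : UniversalEnvelopingAlgebra k 𝔞) :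
    M.envAct 1 a = algebraMap k _ (counit a) := by
  refine left_induction (p := LinearMap.eqLocus (M.envAct 1) (Algebra.linearMap k _ ∘ₗ counit))
    ?_ ?_ a
  · simp [LinearMap.mem_eqLocus, envAct_one]
  · intro x v _
    simp [LinearMap.mem_eqLocus, envAct_ι_mul, -ι_apply]

theorem counit_derAct (a : 𝔞) (u : UniversalEnvelopingAlgebra k 𝔤) :
    counit (R := k) (M.derAct a u) = 0 := by
  refine left_induction (p := LinearMap.ker ((counit (R := k)) ∘ₗ M.derAct a)) ?_ ?_ u
  · simp
  · intro x v hv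
    rw [LinearMap.mem_ker, LinearMap.comp_apply] at hv ⊢
    simp [derAct_mul, hv, -ι_apply]

theorem comul_derAct (a : 𝔞) (u : UniversalEnvelopingAlgebra k 𝔤) :
    comul (R := k) (M.derAct a u) =
      (M.derAct a).rTensor _ (comul (R := k) u) + (M.derAct a).lTensor _ (comul (R := k) u) := by
  refine left_induction (p := LinearMap.eqLocus ((comul (R := k)) ∘ₗ M.derAct a)
    (((M.derAct a).rTensor _ + (M.derAct a).lTensor _) ∘ₗ comul)) ?_ ?_ u
  · simp [LinearMap.mem_eqLocus, Algebra.TensorProduct.one_def]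
  · intro x v hv
    rw [LinearMap.mem_eqLocus] at hv ⊢
    simp only [LinearMap.comp_apply, LinearMap.add_apply] at hv ⊢
    simp only [derAct_mul, derAct_ι, map_add, Bialgebra.comul_mul, comul_ι, hv]
    generalize comul (R := k) v = t
    induction t using TensorProduct.induction_on with
    | zero => simp
    | tmul p q =>
      simp [-ι_apply, add_mul, mul_add, derAct_mul, TensorProduct.add_tmul, TensorProduct.tmul_add]
      abel
    | add s t hs ht =>
      simp only [mul_add, map_add] at hs ht ⊢
      have e := congrArg₂ (· + ·) hs ht
      convert e using 1 <;> abel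

theorem antipode_derAct (a : 𝔞) (u : UniversalEnvelopingAlgebra k 𝔤) :
    antipodeMap k 𝔤 (M.derAct a u) = M.derAct a (antipodeMap k 𝔤 u) := by
  refine left_induction (p := LinearMap.eqLocus (antipodeMap k 𝔤 ∘ₗ M.derAct a)
    (M.derAct a ∘ₗ antipodeMap k 𝔤)) ?_ ?_ u
  · simp [LinearMap.mem_eqLocus]
  · intro x v hv
    rw [LinearMap.mem_eqLocus] at hv ⊢
    simp only [LinearMap.comp_apply] at hv ⊢
    simp only [derAct_mul, map_add, antipodeMap_mul, hv, derAct_ι, antipodeMap_ι, map_neg]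
    abel

theorem mul_envAct (h₁ h₂ : UniversalEnvelopingAlgebra k 𝔤) (a : UniversalEnvelopingAlgebra k 𝔞) :
    M.envAct (h₁ * h₂) a =
      LinearMap.mul' k _ (TensorProduct.map (M.envAct h₁) (M.envAct h₂) (comul a)) := by
  have h := left_induction (p := ⨅ h₁, ⨅ h₂, LinearMap.eqLocus (M.envAct (h₁ * h₂))
    (LinearMap.mul' k _ ∘ₗ TensorProduct.map (M.envAct h₁) (M.envAct h₂) ∘ₗ comul)) ?_ ?_ a
  · simp only [Submodule.mem_iInf, LinearMap.mem_eqLocus] at h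
    exact h h₁ h₂
  · simp [LinearMap.mem_eqLocus, envAct_one, Algebra.TensorProduct.one_def]
  · intro x v hv
    simp only [Submodule.mem_iInf, LinearMap.mem_eqLocus, LinearMap.comp_apply] at hv ⊢
    intro h₁ h₂
    rw [envAct_ι_mul, derAct_mul, map_add, LinearMap.add_apply, hv, hv, Bialgebra.comul_mul,
      comul_ι]
    generalize comul (R := k) v = t
    induction t using TensorProduct.induction_on with
    | zero => simp
    | tmul p q => simp [-ι_apply, add_mul, envAct_ι_mul]
    | add s t hs ht =>
      simp only [mul_add, map_add]
      rw [← hs, ← ht]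
      abel

theorem counit_envAct (h : UniversalEnvelopingAlgebra k 𝔤) (a : UniversalEnvelopingAlgebra k 𝔞) :
    counit (R := k) (M.envAct h a) = counit (R := k) h * counit (R := k) a := by
  have key := left_induction (p := ⨅ h, LinearMap.eqLocus ((counit (R := k)) ∘ₗ M.envAct h)
    (counit (R := k) h • counit (R := k))) ?_ ?_ a
  · simp only [Submodule.mem_iInf, LinearMap.mem_eqLocus] at key
    exact key h
  · simp [LinearMap.mem_eqLocus, envAct_one]
  · intro x v hv
    simp only [Submodule.mem_iInf, LinearMap.mem_eqLocus, LinearMap.comp_apply] at hv ⊢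
    intro h
    rw [envAct_ι_mul, hv]
    simp [counit_derAct, -ι_apply]

theorem comul_envAct (h : UniversalEnvelopingAlgebra k 𝔤) (a : UniversalEnvelopingAlgebra k 𝔞) :
    comul (R := k) (M.envAct h a) =
      TensorProduct.map₂ M.envAct M.envAct (comul (R := k) h) (comul (R := k) a) := by
  have key := left_induction (p := ⨅ h, LinearMap.eqLocus ((comul (R := k)) ∘ₗ M.envAct h)
    (TensorProduct.map₂ M.envAct M.envAct (comul (R := k) h) ∘ₗ comul (R := k))) ?_ ?_ a
  · simp only [Submodule.mem_iInf, LinearMap.mem_eqLocus] at key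
    exact key h
  · simp only [Submodule.mem_iInf, LinearMap.mem_eqLocus, LinearMap.comp_apply, envAct_one,
      Bialgebra.comul_one, Algebra.TensorProduct.one_def]
    intro h
    generalize comul (R := k) h = s
    induction s using TensorProduct.induction_on with
    | zero => simp
    | tmul p q => simp [envAct_one]
    | add s t hs ht => rw [map_add, LinearMap.add_apply, ← hs, ← ht]
  · intro x v hv
    simp only [Submodule.mem_iInf, LinearMap.mem_eqLocus, LinearMap.comp_apply] at hv ⊢
    intro h
    rw [envAct_ι_mul, hv, comul_derAct, Bialgebra.comul_mul, comul_ι]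
    generalize comul (R := k) v = t
    generalize comul (R := k) h = s
    induction s using TensorProduct.induction_on with
    | zero => simp
    | tmul p q =>
      induction t using TensorProduct.induction_on with
      | zero => simp
      | tmul b c => simp [-ι_apply, add_mul, envAct_ι_mul]
      | add t₁ t₂ h₁ h₂ =>
        rw [mul_add, LinearMap.map_add (TensorProduct.map₂ M.envAct M.envAct (p ⊗ₜ[k] q)), ← h₁,
          ← h₂]
        exact LinearMap.map_add _ _ _
    | add s₁ s₂ h₁ h₂ =>
      simp only [map_add, LinearMap.add_apply] at h₁ h₂ ⊢
      rw [← h₁, ← h₂]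
      abel

theorem antipode_envAct (h : UniversalEnvelopingAlgebra k 𝔤)
    (a : UniversalEnvelopingAlgebra k 𝔞) :
    antipodeMap k 𝔤 (M.envAct h a) = M.envAct (antipodeMap k 𝔤 h) a := by
  have key := left_induction (p := ⨅ h, LinearMap.eqLocus (antipodeMap k 𝔤 ∘ₗ M.envAct h)
    (M.envAct (antipodeMap k 𝔤 h))) ?_ ?_ a
  · simp only [Submodule.mem_iInf, LinearMap.mem_eqLocus] at key
    exact key h
  · simp [LinearMap.mem_eqLocus, envAct_one]
  · intro x v hv
    simp only [Submodule.mem_iInf, LinearMap.mem_eqLocus, LinearMap.comp_apply] at hv ⊢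
    intro h
    rw [envAct_ι_mul, hv, antipode_derAct, envAct_ι_mul]

/-- The universal envelope `(U(𝔤), ◁◁, U(𝔞))` of a right Lie module `(𝔤, ◁, 𝔞)`. -/
def envelope : RightHopfModule k (UniversalEnvelopingAlgebra k 𝔤)
    (UniversalEnvelopingAlgebra k 𝔞) where
  act := M.envAct
  act_one := M.envAct_one
  act_mul := M.envAct_mul
  one_act := M.envAct_one_left
  mul_act := M.mul_envAct
  counit_act := M.counit_envAct
  comul_act := M.comul_envAct
  antipode_act := M.antipode_envAct

end RightLieModule

/-! ### Eulerian idempotents -/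

namespace UniversalEnvelopingAlgebra

variable (k : Type*) {𝔤 : Type*} [Field k] [LieRing 𝔤] [LieAlgebra k 𝔤]

/-- `id - η ∘ ε`, as an element of the convolution algebra of linear endomorphisms. -/
def idBar (𝔤 : Type*) [LieRing 𝔤] [LieAlgebra k 𝔤] :
    WithConv (UniversalEnvelopingAlgebra k 𝔤 →ₗ[k] UniversalEnvelopingAlgebra k 𝔤) :=
  toConv LinearMap.id - 1

theorem idBar_one : (idBar k 𝔤).ofConv 1 = 0 := by
  simp [idBar, LinearMap.convOne_def]

/-- The product of a list of elements of `𝔤`. -/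
def word (l : List 𝔤) : UniversalEnvelopingAlgebra k 𝔤 := (l.map (ι k)).prod

theorem comul_word (l : List 𝔤) :
    comul (R := k) (word k l) - 1 ⊗ₜ[k] word k l ∈
      Submodule.span k {t | ∃ (a : UniversalEnvelopingAlgebra k 𝔤) (l' : List 𝔤),
        l'.length < l.length ∧ t = a ⊗ₜ[k] word k l'} := by
  induction l with
  | nil => simp [word, Algebra.TensorProduct.one_def]
  | cons x l ih =>
    have e : comul (R := k) (word k (x :: l)) - 1 ⊗ₜ[k] word k (x :: l) =
        ι k x ⊗ₜ[k] word k l + (ι k x ⊗ₜ[k] 1 + 1 ⊗ₜ[k] ι k x) *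
          (comul (R := k) (word k l) - 1 ⊗ₜ[k] word k l) := by
      have : word k (x :: l) = ι k x * word k l := by simp [word]
      rw [this, Bialgebra.comul_mul, comul_ι, mul_sub]
      simp only [add_mul, Algebra.TensorProduct.tmul_mul_tmul, one_mul, mul_one]
      abel
    rw [e]
    refine Submodule.add_mem _ (Submodule.subset_span ⟨_, l, by simp, rfl⟩) ?_
    generalize comul (R := k) (word k l) - 1 ⊗ₜ[k] word k l = r at ih
    induction ih using Submodule.span_induction with
    | mem t ht =>
      obtain ⟨a, l', hl, rfl⟩ := ht
      rw [add_mul, Algebra.TensorProduct.tmul_mul_tmul, Algebra.TensorProduct.tmul_mul_tmul,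
        one_mul, one_mul]
      refine Submodule.add_mem _
        (Submodule.subset_span ⟨_, l', by simp; omega, rfl⟩)
        (Submodule.subset_span ⟨a, x :: l', by simp; omega, ?_⟩)
      simp [word]
    | zero => simp
    | add s t _ _ hs ht => rw [mul_add]; exact Submodule.add_mem _ hs ht
    | smul c t _ ht => rw [mul_smul_comm]; exact Submodule.smul_mem _ c ht

theorem idBar_pow_word (n : ℕ) : ∀ l : List 𝔤, l.length < n →
    (idBar k 𝔤 ^ n).ofConv (word k l) = 0 := by
  induction n with
  | zero => intro l hl; omega
  | succ n ih =>
    intro l hl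
    have h := comul_word k l
    have hz : LinearMap.mul' k _ (TensorProduct.map (idBar k 𝔤).ofConv (idBar k 𝔤 ^ n).ofConv
        (comul (R := k) (word k l) - 1 ⊗ₜ[k] word k l)) = 0 := by
      generalize comul (R := k) (word k l) - 1 ⊗ₜ[k] word k l = r at h
      induction h using Submodule.span_induction with
      | mem t ht =>
        obtain ⟨a, l', hl', rfl⟩ := ht
        simp [ih l' (by omega)]
      | zero => simp
      | add s t _ _ hs ht => rw [map_add, map_add, hs, ht, add_zero]
      | smul c t _ ht => rw [map_smul, map_smul, ht, smul_zero]
    rw [map_sub, map_sub, sub_eq_zero] at hz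
    rw [pow_succ', LinearMap.convMul_def]
    simp only [LinearMap.comp_apply]
    rw [hz]
    simp [idBar_one]

/-- The convolution powers of `id - η ∘ ε` vanish eventually on every element. -/
theorem idBar_pow_eventually (u : UniversalEnvelopingAlgebra k 𝔤) :
    ∃ N, ∀ n, N < n → (idBar k 𝔤 ^ n).ofConv u = 0 := by
  have hu : u ∈ Submodule.span k (Set.range (word k (𝔤 := 𝔤))) := by
    refine left_induction (p := Submodule.span k (Set.range (word k (𝔤 := 𝔤))))
      (Submodule.subset_span ⟨[], by simp [word]⟩) (fun x v hv => ?_) u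
    induction hv using Submodule.span_induction with
    | mem t ht =>
      obtain ⟨l, rfl⟩ := ht
      exact Submodule.subset_span ⟨x :: l, by simp [word]⟩
    | zero => simp
    | add s t _ _ hs ht => rw [mul_add]; exact Submodule.add_mem _ hs ht
    | smul c t _ ht => rw [mul_smul_comm]; exact Submodule.smul_mem _ c ht
  induction hu using Submodule.span_induction with
  | mem t ht =>
    obtain ⟨l, rfl⟩ := ht
    exact ⟨l.length, fun n hn => idBar_pow_word k n l hn⟩
  | zero => exact ⟨0, by simp⟩
  | add s t _ _ hs ht =>
    obtain ⟨N, hN⟩ := hs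
    obtain ⟨M, hM⟩ := ht
    exact ⟨max N M, fun n hn => by rw [map_add, hN n (by omega), hM n (by omega), add_zero]⟩
  | smul c t _ ht =>
    obtain ⟨N, hN⟩ := ht
    exact ⟨N, fun n hn => by rw [map_smul, hN n hn, smul_zero]⟩

/-- The `n`-th term `(-1)ⁿ (id - η ∘ ε)^{* (n + 1)} / (n + 1)` of the convolution logarithm of
the identity. -/
def logTerm (n : ℕ) : UniversalEnvelopingAlgebra k 𝔤 →ₗ[k] UniversalEnvelopingAlgebra k 𝔤 :=
  ((-1 : k) ^ n / (n + 1 : k)) • (idBar k 𝔤 ^ (n + 1)).ofConv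

theorem logTerm_finite (u : UniversalEnvelopingAlgebra k 𝔤) :
    (Function.support fun n => logTerm k n u).Finite := by
  obtain ⟨N, hN⟩ := idBar_pow_eventually k u
  refine (Set.finite_lt_nat N).subset fun n hn => ?_
  by_contra h
  exact hn (by simp [logTerm, hN (n + 1) (by simp at h; omega)])

/-- The first Eulerian idempotent `sol₁ = log_*(id) = ∑_{n ≥ 1} (-1)^{n-1} (id - η ∘ ε)^{* n} / n`
(the sum is finite on every element). In characteristic zero it is the projection of `U(𝔤)` onto
`𝔤` along the scalars and the symmetrizations of `Sⁿ(𝔤)`, `n ≥ 2`. -/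
def sol₁ : UniversalEnvelopingAlgebra k 𝔤 →ₗ[k] UniversalEnvelopingAlgebra k 𝔤 where
  toFun u := ∑ᶠ n : ℕ, logTerm k n u
  map_add' u v := by
    simp only [map_add]
    exact finsum_add_distrib (logTerm_finite k u) (logTerm_finite k v)
  map_smul' c u := by
    simp only [map_smul, RingHom.id_apply]
    exact (smul_finsum' c (logTerm_finite k u)).symm

/-- The Eulerian idempotents `solₙ = sol₁^{* n} / n!`. In characteristic zero `solₙ` is the projection
of `U(𝔤)` onto the symmetrization of `Sⁿ(𝔤)` along those of `Sᵐ(𝔤)`, `m ≠ n`. -/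
def sol (n : ℕ) : UniversalEnvelopingAlgebra k 𝔤 →ₗ[k] UniversalEnvelopingAlgebra k 𝔤 :=
  (n.factorial : k)⁻¹ • (toConv (sol₁ k) ^ n).ofConv

end UniversalEnvelopingAlgebra

/-- The maps `Γₙ = T ∘ solₙ` attached to a coalgebra map `T : U(𝔤) → U(𝔞)`. -/
def Gam {k 𝔤 𝔞 : Type*} [Field k] [LieRing 𝔤] [LieAlgebra k 𝔤] [LieRing 𝔞] [LieAlgebra k 𝔞]
    (T : UniversalEnvelopingAlgebra k 𝔤 →ₗc[k] UniversalEnvelopingAlgebra k 𝔞) (n : ℕ) :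
    UniversalEnvelopingAlgebra k 𝔤 →ₗ[k] UniversalEnvelopingAlgebra k 𝔞 :=
  (T : UniversalEnvelopingAlgebra k 𝔤 →ₗ[k] UniversalEnvelopingAlgebra k 𝔞) ∘ₗ
    UniversalEnvelopingAlgebra.sol k n

end

open scoped TensorProduct
open Coalgebra WithConv

noncomputable section

/-! Two facts carry the theorem. First, `sol₁` takes primitive values (`comul_sol₁`): it is the
convolution logarithm of the identity, and the coproduct is a convolution product of two commuting
algebra morphisms, so the logarithm turns it into a sum. Second, on a product `e * p` with `p`
primitive the operator identity becomes `T (e * p) = T e * T p - T (e ◁◁ T p)`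
(`map_mul_of_primitive`).

Since `sol (n + 1)` is `(n + 1)⁻¹` times the convolution of `sol n` and `sol₁`, applying the second
fact to each product gives the recursion, once `sol n` is moved through the action of `U(𝔞)`
(`sol_envAct`). As `Γ₁` has primitive values, its antipode is a sign, and right multiplication by
`Γ₁` for `#` is exactly the bracket in the recursion (`hash_apply_of_primitive`). Induction from `Γ₀
= η ∘ ε` gives the closed form.

The exponential formula is then `T` applied to `id = ∑ sol n`, a finite sum on each element
(`exists_sol_eq_zero`). Convergence is handled by filtering convolution algebras by vanishing on
words of length less than `N`: modulo such maps, `id - η ∘ ε` is nilpotent, and the exp-log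
identities reduce to congruences in `k[X]` modulo `X ^ N`. -/

/-! ### Truncated exponentials and logarithms -/

namespace Polynomial

variable (k : Type*) [Field k]

/-- The polynomial `∑_{i < N} (-1)ⁱ X^{i + 1} / (i + 1)`, a truncation of `log (1 + X)`. -/
def truncLog (N : ℕ) : k[X] :=
  ∑ i ∈ Finset.range N, ((-1 : k) ^ i / (i + 1 : k)) • X ^ (i + 1)

theorem X_dvd_truncLog (N : ℕ) : X ∣ truncLog k N :=
  Finset.dvd_sum fun i _ => by
    rw [smul_eq_C_mul]
    exact Dvd.dvd.mul_left (dvd_pow_self X (Nat.succ_ne_zero i)) _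

variable [CharZero k]

/-- The derivative is the geometric sum of the powers of `-X`; the defect `(-X) ^ N` is the price of
truncating. -/
theorem one_add_X_mul_derivative_truncLog (N : ℕ) :
    (1 + X) * derivative (truncLog k N) = 1 - (-X) ^ N := by
  have h : derivative (truncLog k N) = ∑ i ∈ Finset.range N, (-X : k[X]) ^ i := by
    rw [truncLog, derivative_sum]
    refine Finset.sum_congr rfl fun i _ => ?_
    have hi : (i + 1 : k) ≠ 0 := Nat.cast_add_one_ne_zero i
    rw [derivative_smul, derivative_X_pow, Nat.add_sub_cancel, smul_eq_C_mul, ← mul_assoc,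
      ← C_mul]
    push_cast
    rw [div_mul_cancel₀ _ hi, neg_pow (X : k[X])]
    simp
  rw [h]
  have := mul_neg_geom_sum (-X : k[X]) N
  rwa [sub_neg_eq_add] at this

theorem derivative_sum_pow_div_factorial (L : k[X]) (N : ℕ) :
    derivative (∑ n ∈ Finset.range (N + 1), (n.factorial : k)⁻¹ • L ^ n) =
      derivative L * ∑ n ∈ Finset.range N, (n.factorial : k)⁻¹ • L ^ n := by
  rw [derivative_sum, Finset.sum_range_succ', Finset.mul_sum]
  simp only [pow_zero, derivative_smul, derivative_one, smul_zero, add_zero]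
  refine Finset.sum_congr rfl fun n _ => ?_
  have hn : (n + 1 : k) ≠ 0 := Nat.cast_add_one_ne_zero n
  rw [derivative_pow, Nat.add_sub_cancel, Nat.factorial_succ, smul_eq_C_mul, smul_eq_C_mul]
  push_cast
  rw [mul_inv, mul_comm (n + 1 : k)⁻¹, C_mul]
  have : (C (n + 1 : k)⁻¹ : k[X]) * C (n + 1 : k) = 1 := by rw [← C_mul, inv_mul_cancel₀ hn, C_1]
  linear_combination (C (n.factorial : k)⁻¹ * L ^ n * derivative L) * this

/-- Uniqueness for the differential equation `(1 + X) D' = D` modulo `X ^ N`: the coefficient of `X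
^ m` determines coefficient `m + 1` of `D` from coefficient `m`, so a zero constant term propagates,
one degree further than the hypothesis. -/
theorem X_pow_dvd_of_derivative {D : k[X]} {N : ℕ} (h0 : D.coeff 0 = 0)
    (h : X ^ N ∣ (1 + X) * derivative D - D) : X ^ (N + 1) ∣ D := by
  rw [X_pow_dvd_iff] at h ⊢
  intro m
  induction m with
  | zero => exact fun _ => h0
  | succ m ih =>
    intro hm
    have h1 := h m (by omega)
    have h2 := ih (by omega)
    have hn : (m + 1 : k) ≠ 0 := Nat.cast_add_one_ne_zero m
    have h3 : (X * derivative D).coeff m = 0 := by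
      cases m with
      | zero => simp
      | succ m => rw [coeff_X_mul, coeff_derivative, h2, zero_mul]
    rw [coeff_sub, add_mul, one_mul, coeff_add, h3, h2, coeff_derivative, add_zero, sub_zero] at h1
    exact (mul_eq_zero.1 h1).resolve_right hn

/-- `exp (log (1 + X)) = 1 + X` modulo `X ^ N`. -/
theorem X_pow_dvd_exp_truncLog (N : ℕ) :
    X ^ N ∣ ∑ n ∈ Finset.range N, (n.factorial : k)⁻¹ • truncLog k N ^ n - (1 + X) := by
  cases N with
  | zero => simp
  | succ N =>
    have hc : (truncLog k (N + 1)).coeff 0 = 0 := X_dvd_iff.1 (X_dvd_truncLog k _)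
    refine X_pow_dvd_of_derivative k ?_ ?_
    · rw [Finset.sum_range_succ']
      have (n : ℕ) : (truncLog k (N + 1) ^ (n + 1)).coeff 0 = 0 := by
        rw [coeff_zero_eq_eval_zero, eval_pow, ← coeff_zero_eq_eval_zero, hc,
          zero_pow (Nat.succ_ne_zero n)]
      simp [this]
    · rw [derivative_sub, derivative_sum_pow_div_factorial, Finset.sum_range_succ]
      have h1 := one_add_X_mul_derivative_truncLog k (N + 1)
      obtain ⟨q, hq⟩ := pow_dvd_pow_of_dvd (X_dvd_truncLog k (N + 1)) N
      rw [hq]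
      generalize ∑ n ∈ Finset.range N, (n.factorial : k)⁻¹ • truncLog k (N + 1) ^ n = E
      -- With `L` the truncated logarithm, two errors remain: `-(-X) ^ (N + 1) * E` from truncating
      -- the logarithm, and `-L ^ N / N!`, the last exponential term, lost on differentiating. Since
      -- `L ^ N = X ^ N * q`, both are multiples of `X ^ N`.
      refine ⟨(-1) ^ N * X * E - (N.factorial : k)⁻¹ • q, ?_⟩
      simp only [derivative_add, derivative_one, derivative_X, smul_eq_C_mul]
      rw [neg_pow] at h1
      linear_combination E * h1

end Polynomial

/-! ### Commuting and nilpotent elements -/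

theorem Commute.aeval_left {k A : Type*} [CommSemiring k] [Semiring A] [Algebra k A] {x y : A}
    (h : Commute x y) (p : Polynomial k) : Commute (Polynomial.aeval x p) y := by
  induction p using Polynomial.induction_on' with
  | add p q hp hq => rw [map_add]; exact hp.add_left hq
  | monomial n a =>
    rw [Polynomial.aeval_monomial]
    exact Commute.mul_left (Algebra.commutes a y) (h.pow_left n)

/-- If `u ≠ 0` has nilpotency class `M + 2`, multiplying `exp u = 1` by `u ^ M` kills every term of
order at least two and leaves `u ^ M + u ^ (M + 1) = u ^ M`, a contradiction. This replaces taking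
logarithms. -/
theorem IsNilpotent.eq_zero_of_exp_eq_one {A : Type*} [Ring A] [Module ℚ A]
    {u : A} (hu : IsNilpotent u) (h : IsNilpotent.exp u = 1) : u = 0 := by
  by_contra hne
  have : Nontrivial A := ⟨u, 0, hne⟩
  obtain ⟨M, hM⟩ : ∃ M, nilpotencyClass u = M + 2 := by
    have h1 := pos_nilpotencyClass_iff.2 hu
    have h2 : nilpotencyClass u ≠ 1 := fun h1 => hne (nilpotencyClass_eq_one.1 h1)
    exact ⟨nilpotencyClass u - 2, by omega⟩
  have hz : u ^ (M + 2) = 0 := hM ▸ pow_nilpotencyClass hu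
  have hnz : u ^ (M + 1) ≠ 0 := by
    have := pow_pred_nilpotencyClass hu
    rwa [hM] at this
  apply hnz
  have h3 := congrArg (u ^ M * ·) h
  simp only [IsNilpotent.exp_eq_sum hz, Finset.sum_range_succ', Finset.mul_sum, mul_add,
    pow_zero] at h3
  rw [Finset.sum_eq_zero] at h3
  · rw [_root_.pow_succ]
    simpa using h3
  · intro i _
    have : u ^ M * ((i + 1 + 1).factorial : ℚ)⁻¹ • u ^ (i + 1 + 1) =
        ((i + 1 + 1).factorial : ℚ)⁻¹ • (u ^ M * u ^ (i + 1 + 1)) :=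
      map_rat_smul (AddMonoidHom.mulLeft (u ^ M)) _ _
    rw [this, ← pow_add, pow_eq_zero_of_le (by omega) hz, smul_zero]

/-! ### The filtration of convolution algebras by vanishing on short words -/

namespace UniversalEnvelopingAlgebra

section Small

variable {k 𝔤 : Type*} [Field k] [LieRing 𝔤] [LieAlgebra k 𝔤]

theorem word_cons (x : 𝔤) (l : List 𝔤) : word k (x :: l) = ι k x * word k l := by
  simp [word]

/-- The coproduct distributes the letters of a word between the two factors, so lengths add; this
makes the filtration multiplicative. -/
theorem comul_word_mem (l : List 𝔤) :
    comul (R := k) (word k l) ∈ Submodule.span k {t | ∃ l₁ l₂ : List 𝔤,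
      l₁.length + l₂.length = l.length ∧ t = word k l₁ ⊗ₜ[k] word k l₂} := by
  induction l with
  | nil =>
    exact Submodule.subset_span ⟨[], [], rfl, by simp [word, Algebra.TensorProduct.one_def]⟩
  | cons x l ih =>
    rw [word_cons, Bialgebra.comul_mul, comul_ι]
    generalize comul (R := k) (word k l) = r at ih
    induction ih using Submodule.span_induction with
    | mem t ht =>
      obtain ⟨l₁, l₂, hl, rfl⟩ := ht
      rw [add_mul, Algebra.TensorProduct.tmul_mul_tmul, Algebra.TensorProduct.tmul_mul_tmul,
        one_mul, one_mul, ← word_cons, ← word_cons]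
      exact Submodule.add_mem _
        (Submodule.subset_span ⟨x :: l₁, l₂, by simp; omega, rfl⟩)
        (Submodule.subset_span ⟨l₁, x :: l₂, by simp; omega, rfl⟩)
    | zero => simp
    | add s t _ _ hs ht => rw [mul_add]; exact Submodule.add_mem _ hs ht
    | smul c t _ ht => rw [mul_smul_comm]; exact Submodule.smul_mem _ c ht

theorem span_range_word : Submodule.span k (Set.range (word k (𝔤 := 𝔤))) = ⊤ := by
  refine eq_top_iff.2 fun u _ => left_induction
    (p := Submodule.span k (Set.range (word k (𝔤 := 𝔤))))
    (Submodule.subset_span ⟨[], by simp [word]⟩) (fun x v hv => ?_) u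
  induction hv using Submodule.span_induction with
  | mem t ht =>
    obtain ⟨l, rfl⟩ := ht
    exact Submodule.subset_span ⟨x :: l, word_cons x l⟩
  | zero => simp
  | add s t _ _ hs ht => rw [mul_add]; exact Submodule.add_mem _ hs ht
  | smul c t _ ht => rw [mul_smul_comm]; exact Submodule.smul_mem _ c ht

variable {A : Type*} [Ring A] [Algebra k A]

theorem convMul_word_eq_zero {F G : WithConv (UniversalEnvelopingAlgebra k 𝔤 →ₗ[k] A)} {m n : ℕ}
    (hF : ∀ l : List 𝔤, l.length < m → F.ofConv (word k l) = 0)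
    (hG : ∀ l : List 𝔤, l.length < n → G.ofConv (word k l) = 0) (l : List 𝔤)
    (hl : l.length < m + n) : (F * G).ofConv (word k l) = 0 := by
  have h := comul_word_mem (k := k) l
  rw [LinearMap.convMul_def]
  simp only [LinearMap.comp_apply]
  generalize comul (R := k) (word k l) = r at h
  induction h using Submodule.span_induction with
  | mem t ht =>
    obtain ⟨l₁, l₂, h, rfl⟩ := ht
    -- The lengths sum to less than `m + n`, so one of the two factors is too short to be seen.
    rcases lt_or_ge l₁.length m with h1 | h1
    · simp [hF l₁ h1]
    · simp [hG l₂ (by omega)]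
  | zero => simp
  | add s t _ _ hs ht => rw [map_add, map_add, hs, ht, add_zero]
  | smul c t _ ht => rw [map_smul, map_smul, ht, smul_zero]

variable (k 𝔤 A) in
/-- The ideal of linear maps that vanish on all words of length less than `n`. -/
def small (n : ℕ) : Ideal (WithConv (UniversalEnvelopingAlgebra k 𝔤 →ₗ[k] A)) where
  carrier := {F | ∀ l : List 𝔤, l.length < n → F.ofConv (word k l) = 0}
  add_mem' hF hG l hl := by simp [hF l hl, hG l hl]
  zero_mem' l _ := by simp
  smul_mem' F G hG l hl :=
    -- At level `0` the vanishing condition is empty, so the other factor may be arbitrary.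
    convMul_word_eq_zero (m := 0) (n := n) (fun _ h => absurd h (Nat.not_lt_zero _)) hG l (by omega)

theorem mem_small {n : ℕ} {F : WithConv (UniversalEnvelopingAlgebra k 𝔤 →ₗ[k] A)} :
    F ∈ small k 𝔤 A n ↔ ∀ l : List 𝔤, l.length < n → F.ofConv (word k l) = 0 := Iff.rfl

theorem mul_mem_small {m n : ℕ} {F G : WithConv (UniversalEnvelopingAlgebra k 𝔤 →ₗ[k] A)}
    (hF : F ∈ small k 𝔤 A m) (hG : G ∈ small k 𝔤 A n) : F * G ∈ small k 𝔤 A (m + n) :=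
  convMul_word_eq_zero hF hG

instance (n : ℕ) : (small k 𝔤 A n).IsTwoSided where
  mul_mem_of_left _ hF := mul_mem_small (n := 0) hF fun _ h => absurd h (Nat.not_lt_zero _)

theorem small_antitone : Antitone (small k 𝔤 A) :=
  fun _ _ h _ hF l hl => hF l (lt_of_lt_of_le hl h)

theorem pow_mem_small {F : WithConv (UniversalEnvelopingAlgebra k 𝔤 →ₗ[k] A)}
    (hF : F ∈ small k 𝔤 A 1) (n : ℕ) : F ^ n ∈ small k 𝔤 A n := by
  induction n with
  | zero => exact fun _ h => absurd h (Nat.not_lt_zero _)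
  | succ n ih => rw [pow_succ]; exact mul_mem_small ih hF

theorem mem_small_one {F : WithConv (UniversalEnvelopingAlgebra k 𝔤 →ₗ[k] A)} :
    F ∈ small k 𝔤 A 1 ↔ F.ofConv 1 = 0 := by
  rw [mem_small]
  constructor
  · exact fun h => by simpa [word] using h [] (by simp)
  · intro h l hl
    obtain rfl : l = [] := by simpa using hl
    simpa [word] using h

/-- Every element is a combination of words of bounded length. -/
theorem exists_forall_small_apply_eq_zero (u : UniversalEnvelopingAlgebra k 𝔤) :
    ∃ N, ∀ F ∈ small k 𝔤 A N, F.ofConv u = 0 := by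
  have hu : u ∈ Submodule.span k (Set.range (word k (𝔤 := 𝔤))) := by
    rw [span_range_word]; trivial
  induction hu using Submodule.span_induction with
  | mem t ht =>
    obtain ⟨l, rfl⟩ := ht
    exact ⟨l.length + 1, fun F hF => hF l (Nat.lt_succ_self _)⟩
  | zero => exact ⟨0, by simp⟩
  | add s t _ _ hs ht =>
    obtain ⟨N, hN⟩ := hs
    obtain ⟨M, hM⟩ := ht
    exact ⟨max N M, fun F hF => by
      rw [map_add, hN F (small_antitone (le_max_left _ _) hF),
        hM F (small_antitone (le_max_right _ _) hF), add_zero]⟩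
  | smul c t _ ht =>
    obtain ⟨N, hN⟩ := ht
    exact ⟨N, fun F hF => by rw [map_smul, hN F hF, smul_zero]⟩

/-- The filtration is separated, so identities of linear maps may be checked modulo every level. -/
theorem eq_of_forall_sub_mem_small {F G : WithConv (UniversalEnvelopingAlgebra k 𝔤 →ₗ[k] A)}
    (h : ∀ n, F - G ∈ small k 𝔤 A n) : F = G := by
  refine WithConv.ofConv_injective (LinearMap.ext fun u => ?_)
  obtain ⟨N, hN⟩ := exists_forall_small_apply_eq_zero (A := A) u
  simpa [sub_eq_zero] using hN _ (h N)

end Small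

/-! ### The Eulerian idempotents -/

section Sol

variable {k 𝔤 : Type*} [Field k] [LieRing 𝔤] [LieAlgebra k 𝔤] {A : Type*} [Ring A] [Algebra k A]

variable (k 𝔤) in
theorem idBar_mem_small : idBar k 𝔤 ∈ small k 𝔤 _ 1 := mem_small_one.2 (idBar_one k)

variable (k 𝔤) in
theorem sol₁_sub_aeval_mem_small (N : ℕ) :
    toConv (sol₁ k) - Polynomial.aeval (idBar k 𝔤) (Polynomial.truncLog k N) ∈ small k 𝔤 _ N := by
  intro l hl
  have h : sol₁ k (word k l) = ∑ n ∈ Finset.range N, logTerm k n (word k l) := by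
    refine finsum_eq_sum_of_support_subset _ fun n hn => ?_
    by_contra hn'
    refine hn ?_
    -- The `n`-th term contains the power `n + 1`, so it vanishes on words of length at most `n`, in
    -- particular for `n ≥ N`.
    have : l.length < n + 1 := by simp at hn'; omega
    simp [logTerm, idBar_pow_word k (n + 1) l this]
  rw [WithConv.ofConv_sub, LinearMap.sub_apply, ofConv_toConv, h, Polynomial.truncLog, map_sum]
  simp only [map_smul, map_pow, Polynomial.aeval_X]
  simp [logTerm]

/-- Postcomposition with an algebra morphism, as a morphism of convolution algebras. -/
def postcomp {B : Type*} [Ring B] [Algebra k B] (φ : A →ₐ[k] B) :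
    WithConv (UniversalEnvelopingAlgebra k 𝔤 →ₗ[k] A) →ₐ[k]
      WithConv (UniversalEnvelopingAlgebra k 𝔤 →ₗ[k] B) :=
  AlgHom.ofLinearMap
    { toFun := fun F => toConv (φ.toLinearMap ∘ₗ F.ofConv)
      map_add' := fun F G => by ext; simp
      map_smul' := fun c F => by ext; simp }
    (by ext; simp)
    (fun F G => congrArg toConv (LinearMap.algHom_comp_convMul_distrib φ F G))

theorem postcomp_mem_small {B : Type*} [Ring B] [Algebra k B] (φ : A →ₐ[k] B) {n : ℕ}
    {F : WithConv (UniversalEnvelopingAlgebra k 𝔤 →ₗ[k] A)} (hF : F ∈ small k 𝔤 A n) :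
    postcomp φ F ∈ small k 𝔤 B n := fun l hl => by
  simp [postcomp, hF l hl]

end Sol

end UniversalEnvelopingAlgebra

namespace UniversalEnvelopingAlgebra

/-! ### The exponential of `sol₁` modulo short words, and primitivity of its values -/

section ExpSol

variable {k 𝔤 : Type*} [Field k] [LieRing 𝔤] [LieAlgebra k 𝔤] {A : Type*} [Ring A] [Algebra k A]

variable (k 𝔤 A) in
/-- The convolution algebra modulo maps vanishing on words of length less than `N`. -/
abbrev quotSmall (N : ℕ) : Type _ :=
  WithConv (UniversalEnvelopingAlgebra k 𝔤 →ₗ[k] A) ⧸ small k 𝔤 A N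

/-- The class of `φ ∘ F` modulo maps vanishing on words of length less than `N`. -/
def mkPostcomp (N : ℕ) (φ : UniversalEnvelopingAlgebra k 𝔤 →ₐ[k] A) :
    WithConv (UniversalEnvelopingAlgebra k 𝔤 →ₗ[k] UniversalEnvelopingAlgebra k 𝔤) →ₐ[k]
      quotSmall k 𝔤 A N :=
  (Ideal.Quotient.mkₐ k (small k 𝔤 A N)).comp (postcomp φ)

theorem mkPostcomp_eq_zero {N : ℕ} (φ : UniversalEnvelopingAlgebra k 𝔤 →ₐ[k] A)
    {F : WithConv (UniversalEnvelopingAlgebra k 𝔤 →ₗ[k] UniversalEnvelopingAlgebra k 𝔤)}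
    (hF : F ∈ small k 𝔤 _ N) : mkPostcomp N φ F = 0 :=
  Ideal.Quotient.eq_zero_iff_mem.2 (postcomp_mem_small φ hF)

/-- Modulo short words `sol₁` is a polynomial in the class of `idBar`; its exponential and its
commutation relations follow from this. -/
theorem mkPostcomp_sol₁ (N : ℕ) (φ : UniversalEnvelopingAlgebra k 𝔤 →ₐ[k] A) :
    mkPostcomp N φ (toConv (sol₁ k)) =
      Polynomial.aeval (mkPostcomp N φ (idBar k 𝔤)) (Polynomial.truncLog k N) := by
  have h := mkPostcomp_eq_zero φ (sol₁_sub_aeval_mem_small k 𝔤 N)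
  rwa [map_sub, sub_eq_zero, ← Polynomial.aeval_algHom_apply] at h

theorem sol₁_mem_small : toConv (sol₁ k) ∈ small k 𝔤 _ 1 := by
  have h := sol₁_sub_aeval_mem_small k 𝔤 1
  have h2 : Polynomial.aeval (idBar k 𝔤) (Polynomial.truncLog k 1) = idBar k 𝔤 := by
    simp [Polynomial.truncLog]
  rw [h2] at h
  simpa using (small k 𝔤 _ 1).add_mem h (idBar_mem_small k 𝔤)

theorem mkPostcomp_sol₁_pow (N : ℕ) (φ : UniversalEnvelopingAlgebra k 𝔤 →ₐ[k] A) :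
    mkPostcomp N φ (toConv (sol₁ k)) ^ N = 0 := by
  rw [← map_pow]
  exact mkPostcomp_eq_zero φ (pow_mem_small sol₁_mem_small N)

theorem sol_mem_small (n : ℕ) : toConv (sol k n) ∈ small k 𝔤 _ n :=
  fun l hl => by simp [sol, pow_mem_small sol₁_mem_small n l hl]

variable [CharZero k]

/-- This is `exp (log (1 + X)) = 1 + X` evaluated at the class of `idBar`, whose `N`-th power is
zero. A general `φ` is allowed because the coproduct and both inclusions into the tensor square are
needed. -/
theorem sum_mkPostcomp_sol₁ (N : ℕ) (φ : UniversalEnvelopingAlgebra k 𝔤 →ₐ[k] A) :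
    ∑ n ∈ Finset.range N, (n.factorial : k)⁻¹ • mkPostcomp N φ (toConv (sol₁ k)) ^ n =
      mkPostcomp N φ (toConv LinearMap.id) := by
  obtain ⟨q, hq⟩ := Polynomial.X_pow_dvd_exp_truncLog k N
  have h := congrArg (Polynomial.aeval (mkPostcomp N φ (idBar k 𝔤))) hq
  have hJ : mkPostcomp N φ (idBar k 𝔤) ^ N = 0 := by
    rw [← map_pow]
    exact mkPostcomp_eq_zero φ (pow_mem_small (idBar_mem_small k 𝔤) N)
  rw [map_mul, map_pow, Polynomial.aeval_X, hJ, zero_mul, map_sub, sub_eq_zero, map_sum] at h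
  simp only [map_smul, map_pow, ← mkPostcomp_sol₁] at h
  rw [h, map_add, map_one, Polynomial.aeval_X, ← map_one (mkPostcomp N φ), ← map_add, idBar,
    add_sub_cancel]

theorem sum_sol_sub_id_mem_small (N : ℕ) :
    ∑ n ∈ Finset.range N, toConv (sol k n) - toConv LinearMap.id ∈ small k 𝔤 _ N := by
  have h := sum_mkPostcomp_sol₁ (k := k) (𝔤 := 𝔤) N (AlgHom.id k _)
  simp only [← map_pow, ← map_smul] at h
  rw [← map_sum, ← sub_eq_zero, ← map_sub] at h
  exact Ideal.Quotient.eq_zero_iff_mem.1 h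

theorem exists_sol_eq_zero (u : UniversalEnvelopingAlgebra k 𝔤) :
    ∃ N, (∀ n, N ≤ n → sol k n u = 0) ∧ ∑ n ∈ Finset.range N, sol k n u = u := by
  obtain ⟨N, hN⟩ := exists_forall_small_apply_eq_zero
    (A := UniversalEnvelopingAlgebra k 𝔤) u
  refine ⟨N, fun n hn => hN _ (small_antitone hn (sol_mem_small n)), ?_⟩
  simpa [sub_eq_zero] using hN _ (sum_sol_sub_id_mem_small N)

/-- The first Eulerian idempotent takes primitive values. -/
theorem comul_sol₁ (u : UniversalEnvelopingAlgebra k 𝔤) :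
    comul (R := k) (sol₁ k u) = sol₁ k u ⊗ₜ[k] 1 + 1 ⊗ₜ[k] sol₁ k u := by
  let H := UniversalEnvelopingAlgebra k 𝔤
  let i₁ : H →ₐ[k] H ⊗[k] H := Algebra.TensorProduct.includeLeft
  let i₂ : H →ₐ[k] H ⊗[k] H := Algebra.TensorProduct.includeRight
  let δ : H →ₐ[k] H ⊗[k] H := Bialgebra.comulAlgHom k H
  let e : WithConv (H →ₗ[k] H) := toConv LinearMap.id
  -- The coproduct factors because `(p ⊗ 1) * (1 ⊗ q) = p ⊗ q`.
  have hmul : postcomp i₁ e * postcomp i₂ e = postcomp δ e := by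
    refine WithConv.ofConv_injective (LinearMap.ext fun h => ?_)
    simp only [LinearMap.convMul_def, postcomp, e, i₁, i₂, δ, AlgHom.ofLinearMap_apply,
      LinearMap.coe_mk, AddHom.coe_mk, LinearMap.comp_apply, LinearMap.comp_id]
    change _ = comul (R := k) h
    generalize comul (R := k) h = t
    induction t using TensorProduct.induction_on with
    | zero => simp
    | tmul p q =>
      change (p ⊗ₜ[k] (1 : H)) * ((1 : H) ⊗ₜ[k] q) = _
      simp
    | add s t hs ht => rw [map_add, map_add, hs, ht]
  have hcomm : Commute (postcomp i₁ e) (postcomp i₂ e) := by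
    refine WithConv.ofConv_injective (LinearMap.ext fun h => ?_)
    simp only [LinearMap.convMul_def, postcomp, e, i₁, i₂, AlgHom.ofLinearMap_apply,
      LinearMap.coe_mk, AddHom.coe_mk, LinearMap.comp_apply, LinearMap.comp_id]
    -- The factors commute by cocommutativity: swapping the legs of the second coproduct matches the
    -- two products.
    nth_rw 2 [← comm_comul k h]
    generalize comul (R := k) h = t
    induction t using TensorProduct.induction_on with
    | zero => simp
    | tmul p q =>
      change (p ⊗ₜ[k] (1 : H)) * ((1 : H) ⊗ₜ[k] q) = ((1 : H) ⊗ₜ[k] q) * (p ⊗ₜ[k] (1 : H))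
      simp
    | add s t hs ht => simp only [map_add, hs, ht]
  suffices h : postcomp δ (toConv (sol₁ k)) =
      postcomp i₁ (toConv (sol₁ k)) + postcomp i₂ (toConv (sol₁ k)) from
    congrArg (fun F => F.ofConv u) h
  refine eq_of_forall_sub_mem_small fun N => Ideal.Quotient.eq_zero_iff_mem.1 ?_
  let _ : Module ℚ (quotSmall k 𝔤 (H ⊗[k] H) N) := Module.compHom _ (algebraMap ℚ k)
  have hexp (φ : H →ₐ[k] H ⊗[k] H) :
      IsNilpotent.exp (mkPostcomp N φ (toConv (sol₁ k))) = mkPostcomp N φ e := by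
    rw [IsNilpotent.exp_eq_sum (mkPostcomp_sol₁_pow N φ), ← sum_mkPostcomp_sol₁]
    refine Finset.sum_congr rfl fun n _ => ?_
    rw [← Rat.cast_smul_eq_qsmul k, Rat.cast_inv, Rat.cast_natCast]
  have hnil (φ : H →ₐ[k] H ⊗[k] H) : IsNilpotent (mkPostcomp N φ (toConv (sol₁ k))) :=
    ⟨N, mkPostcomp_sol₁_pow N φ⟩
  -- Commutation passes from the morphisms to their logarithms, which are polynomials in them modulo
  -- short words.
  have hc {φ ψ : H →ₐ[k] H ⊗[k] H} (h : Commute (postcomp φ e) (postcomp ψ e)) :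
      Commute (mkPostcomp N φ (toConv (sol₁ k))) (mkPostcomp N ψ (toConv (sol₁ k))) := by
    rw [mkPostcomp_sol₁, mkPostcomp_sol₁]
    have h' : Commute (mkPostcomp N φ (idBar k 𝔤)) (mkPostcomp N ψ (idBar k 𝔤)) := by
      have h1 := h.map (Ideal.Quotient.mkₐ k (small k 𝔤 (H ⊗[k] H) N))
      rw [idBar, map_sub, map_sub, map_one, map_one]
      exact (h1.sub_left (Commute.one_left _)).sub_right
        ((Commute.one_right _).sub_left (Commute.one_right _))
    exact (h'.aeval_left _).symm.aeval_left _ |>.symm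
  have hc₁ : Commute (postcomp δ e) (postcomp i₁ e) := by
    rw [← hmul]; exact (Commute.refl _).mul_left hcomm.symm
  have hc₂ : Commute (postcomp δ e) (postcomp i₂ e) := by
    rw [← hmul]; exact hcomm.mul_left (Commute.refl _)
  have hc₃ := (hc hc₁).add_right (hc hc₂)
  have hn₃ := (hc hcomm).isNilpotent_add (hnil i₁) (hnil i₂)
  have hsum : IsNilpotent.exp (mkPostcomp N δ (toConv (sol₁ k))) =
      IsNilpotent.exp (mkPostcomp N i₁ (toConv (sol₁ k)) +
        mkPostcomp N i₂ (toConv (sol₁ k))) := by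
    rw [IsNilpotent.exp_add_of_commute (hc hcomm) (hnil i₁) (hnil i₂), hexp, hexp, hexp]
    exact (congrArg (Ideal.Quotient.mkₐ k _) hmul).symm
  -- Both sides have the same exponential; as they commute, their difference is nilpotent with
  -- exponential `1`, hence zero.
  have hu : mkPostcomp N δ (toConv (sol₁ k)) - (mkPostcomp N i₁ (toConv (sol₁ k)) +
      mkPostcomp N i₂ (toConv (sol₁ k))) = 0 := by
    refine IsNilpotent.eq_zero_of_exp_eq_one (hc₃.isNilpotent_sub (hnil δ) hn₃) ?_
    rw [sub_eq_add_neg, IsNilpotent.exp_add_of_commute hc₃.neg_right (hnil δ) hn₃.neg, hsum,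
      IsNilpotent.exp_mul_exp_neg_self hn₃]
  exact hu

end ExpSol

end UniversalEnvelopingAlgebra

/-! ### Equivariance of the Eulerian idempotents -/

namespace RightLieModule

open UniversalEnvelopingAlgebra

section Equivariance

variable {k 𝔤 𝔞 : Type*} [Field k] [LieRing 𝔤] [LieAlgebra k 𝔤] [LieRing 𝔞] [LieAlgebra k 𝔞]
  (M : RightLieModule k 𝔤 𝔞)

/-- `derAct a` is both a derivation and a coderivation, so its commutant is closed under
convolution. -/
theorem derAct_convMul {F G : WithConv (UniversalEnvelopingAlgebra k 𝔤 →ₗ[k]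
    UniversalEnvelopingAlgebra k 𝔤)} {a : 𝔞} (hF : Commute F.ofConv (M.derAct a))
    (hG : Commute G.ofConv (M.derAct a)) : Commute (F * G).ofConv (M.derAct a) := by
  have hF' (u) : F.ofConv (M.derAct a u) = M.derAct a (F.ofConv u) := congr($hF u)
  have hG' (u) : G.ofConv (M.derAct a u) = M.derAct a (G.ofConv u) := congr($hG u)
  refine LinearMap.ext fun u => ?_
  simp only [LinearMap.convMul_def, Module.End.mul_apply, LinearMap.comp_apply, comul_derAct]
  generalize comul (R := k) u = t
  induction t using TensorProduct.induction_on with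
  | zero => simp
  | tmul p q => simp [derAct_mul, hF', hG']
  | add s t hs ht =>
    simp only [map_add] at hs ht ⊢
    rw [← hs, ← ht]
    abel

theorem derAct_convPow {F : WithConv (UniversalEnvelopingAlgebra k 𝔤 →ₗ[k]
    UniversalEnvelopingAlgebra k 𝔤)} {a : 𝔞} (hF : Commute F.ofConv (M.derAct a)) (n : ℕ) :
    Commute (F ^ n).ofConv (M.derAct a) := by
  induction n with
  | zero =>
    refine LinearMap.ext fun u => ?_
    simp [LinearMap.convOne_def, counit_derAct, Algebra.algebraMap_eq_smul_one]
  | succ n ih => rw [pow_succ]; exact M.derAct_convMul ih hF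

theorem sol_derAct (n : ℕ) (a : 𝔞) (u : UniversalEnvelopingAlgebra k 𝔤) :
    sol k n (M.derAct a u) = M.derAct a (sol k n u) := by
  have hJ : Commute (idBar k 𝔤).ofConv (M.derAct a) := by
    rw [idBar, WithConv.ofConv_sub]
    -- Two units occur: `id` is the unit for composition, while `η ∘ ε`, the convolution unit, is
    -- obtained as a zeroth convolution power.
    exact Commute.sub_left (Commute.one_left _) (M.derAct_convPow (F := 0) (Commute.zero_left _) 0)
  have hs : Commute (toConv (sol₁ k)).ofConv (M.derAct a) := by
    refine LinearMap.ext fun v => ?_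
    change ∑ᶠ n, logTerm k n (M.derAct a v) = M.derAct a (∑ᶠ n, logTerm k n v)
    refine Eq.trans (finsum_congr fun n => ?_)
      ((M.derAct a).toAddMonoidHom.map_finsum (logTerm_finite k v)).symm
    simpa [logTerm] using
      congrArg (((-1 : k) ^ n / (n + 1 : k)) • ·) congr($(M.derAct_convPow hJ (n + 1)) v)
  simpa [sol] using congrArg ((n.factorial : k)⁻¹ • ·) congr($(M.derAct_convPow hs n) u)

end Equivariance

end RightLieModule

/-! ### Operators and primitive elements -/

namespace RightHopfModule

section Primitive

variable {k K : Type*} [CommRing k] [Ring K] [HopfAlgebra k K]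

theorem counit_eq_zero_of_primitive {b : K}
    (hb : comul (R := k) b = b ⊗ₜ[k] 1 + 1 ⊗ₜ[k] b) : counit (R := k) b = 0 := by
  have h := rTensor_counit_comul (R := k) b
  rw [hb, map_add, LinearMap.rTensor_tmul, LinearMap.rTensor_tmul, Bialgebra.counit_one] at h
  have h' := congrArg (TensorProduct.lid k K) h
  simp only [map_add, TensorProduct.lid_tmul, one_smul, add_eq_right] at h'
  -- So far only the multiple `ε(b) • 1` in `K` is known to vanish; applying the counit recovers the
  -- scalar.
  have h2 := congrArg (counit (R := k)) h'
  simpa using h2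

theorem antipode_eq_neg_of_primitive {b : K}
    (hb : comul (R := k) b = b ⊗ₜ[k] 1 + 1 ⊗ₜ[k] b) : HopfAlgebra.antipode k b = -b := by
  have h := HopfAlgebra.mul_antipode_rTensor_comul_apply (R := k) b
  rw [hb, counit_eq_zero_of_primitive hb] at h
  simp only [map_add, LinearMap.rTensor_tmul, LinearMap.mul'_apply, HopfAlgebra.antipode_one,
    mul_one, one_mul, map_zero] at h
  exact eq_neg_of_add_eq_zero_left h

end Primitive

section Operator

variable {k H K : Type*} [CommRing k] [Ring H] [Ring K] [HopfAlgebra k H] [HopfAlgebra k K]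
  [IsCocomm k H] [IsCocomm k K] (M : RightHopfModule k H K)

/-- `A # B = A * B - A ∘ (id ◁◁ B)` if `B` takes primitive values. -/
theorem hash_apply_of_primitive (A B : H →ₗ[k] K)
    (hB : ∀ f, comul (R := k) (B f) = B f ⊗ₜ[k] 1 + 1 ⊗ₜ[k] B f) (f : H) :
    M.hash A B f = (toConv A * toConv B).ofConv f - A (M.idAct B f) := by
  simp only [hash, idAct, LinearMap.convMul_def, LinearMap.comp_apply, ofConv_toConv]
  generalize comul (R := k) f = t
  induction t using TensorProduct.induction_on with
  | zero => simp
  | tmul p q =>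
    -- The two terms of the coproduct of `B q` give `-A (p ◁◁ B q)` and `A p * B q`.
    simp [hB, antipode_eq_neg_of_primitive (hB q), TensorProduct.tmul_add, M.act_one]
    abel
  | add s t hs ht =>
    simp only [map_add, hs, ht]
    abel

variable {M} {T : H →ₗc[k] K}

/-- `T 1` is group-like, hence invertible with inverse its antipode, and the operator identity at `e
= f = 1` makes it idempotent. -/
theorem IsOHopfOperator.map_one (hT : M.IsOHopfOperator T) : T 1 = 1 := by
  have h1 : T 1 * T 1 = T 1 := by
    have := hT 1 1
    simpa [Bialgebra.comul_one, Algebra.TensorProduct.one_def, M.one_act] using this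
  have hg : comul (R := k) (T 1) = T 1 ⊗ₜ[k] T 1 := by
    rw [← CoalgHomClass.map_comp_comul_apply]
    simp [Bialgebra.comul_one, Algebra.TensorProduct.one_def]
  have h := HopfAlgebra.mul_antipode_rTensor_comul_apply (R := k) (T 1)
  rw [hg, CoalgHomClass.counit_comp_apply, Bialgebra.counit_one, RingHom.map_one] at h
  simp only [LinearMap.rTensor_tmul, LinearMap.mul'_apply] at h
  calc T 1 = (HopfAlgebra.antipode k (T 1) * T 1) * T 1 := by rw [h, one_mul]
    _ = 1 := by rw [mul_assoc, h1, h]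

theorem IsOHopfOperator.comul_map_of_primitive (hT : M.IsOHopfOperator T) {p : H}
    (hp : comul (R := k) p = p ⊗ₜ[k] 1 + 1 ⊗ₜ[k] p) :
    comul (R := k) (T p) = T p ⊗ₜ[k] 1 + 1 ⊗ₜ[k] T p := by
  rw [← CoalgHomClass.map_comp_comul_apply, hp]
  simp [hT.map_one]

/-- For primitive `p` the argument of `T` in the operator identity is `e ◁◁ T p + e * p`, because `T
1 = 1` acts trivially. -/
theorem IsOHopfOperator.map_mul_of_primitive (hT : M.IsOHopfOperator T) (e : H) {p : H}
    (hp : comul (R := k) p = p ⊗ₜ[k] 1 + 1 ⊗ₜ[k] p) :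
    T (e * p) = T e * T p - T (M.act e (T p)) := by
  rw [hT, hp]
  simp [hT.map_one, M.act_one]

end Operator

end RightHopfModule

/-! ### The maps `Γₙ` -/

section Gam

open UniversalEnvelopingAlgebra

variable {k 𝔤 𝔞 : Type*} [Field k] [LieRing 𝔤] [LieAlgebra k 𝔤] [LieRing 𝔞]
    [LieAlgebra k 𝔞] {M : RightLieModule k 𝔤 𝔞}
    {T : UniversalEnvelopingAlgebra k 𝔤 →ₗc[k] UniversalEnvelopingAlgebra k 𝔞}

theorem UniversalEnvelopingAlgebra.sol_one : sol k 1 = sol₁ k (𝔤 := 𝔤) := by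
  simp [sol]

theorem UniversalEnvelopingAlgebra.sol_succ (n : ℕ) (f : UniversalEnvelopingAlgebra k 𝔤) :
    sol k (n + 1) f = ((n : k) + 1)⁻¹ • (toConv (sol k n) * toConv (sol₁ k)).ofConv f := by
  rw [sol, sol, pow_succ, WithConv.toConv_smul, smul_mul_assoc, Nat.factorial_succ]
  simp [smul_smul, mul_comm]

theorem RightLieModule.sol_envAct (M : RightLieModule k 𝔤 𝔞) (n : ℕ)
    (u : UniversalEnvelopingAlgebra k 𝔤) (b : UniversalEnvelopingAlgebra k 𝔞) :
    sol k n (M.envAct u b) = M.envAct (sol k n u) b := by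
  -- The induction treats all `u` at once, since splitting off a letter `x` replaces `u` by `derAct
  -- x u`.
  have key := left_induction (p := ⨅ u, LinearMap.eqLocus (sol k n ∘ₗ M.envAct u)
    (M.envAct (sol k n u))) ?_ ?_ b
  · simp only [Submodule.mem_iInf, LinearMap.mem_eqLocus] at key
    exact key u
  · simp [LinearMap.mem_eqLocus, M.envAct_one]
  · intro x v hv
    simp only [Submodule.mem_iInf, LinearMap.mem_eqLocus, LinearMap.comp_apply] at hv ⊢
    intro u
    rw [M.envAct_ι_mul, hv, M.sol_derAct, M.envAct_ι_mul]

theorem Gam_zero (hT : M.envelope.IsOHopfOperator T) :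
    Gam T 0 = Algebra.linearMap k _ ∘ₗ counit := by
  refine LinearMap.ext fun f => ?_
  simp [Gam, sol, LinearMap.convOne_def, Algebra.algebraMap_eq_smul_one, hT.map_one]

variable [CharZero k]

theorem comul_Gam_one (hT : M.envelope.IsOHopfOperator T) (f : UniversalEnvelopingAlgebra k 𝔤) :
    comul (R := k) (Gam T 1 f) = Gam T 1 f ⊗ₜ[k] 1 + 1 ⊗ₜ[k] Gam T 1 f := by
  rw [Gam, sol_one]
  exact hT.comul_map_of_primitive (comul_sol₁ f)

theorem Gam_succ (hT : M.envelope.IsOHopfOperator T) (n : ℕ)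
    (f : UniversalEnvelopingAlgebra k 𝔤) :
    Gam T (n + 1) f = ((n : k) + 1)⁻¹ •
      ((toConv (Gam T n) * toConv (Gam T 1)).ofConv f -
        Gam T n (M.envelope.idAct (Gam T 1) f)) := by
  change T (sol k (n + 1) f) = _
  rw [sol_succ, map_smul]
  congr 1
  simp only [LinearMap.convMul_def, ofConv_toConv, LinearMap.comp_apply,
    RightHopfModule.idAct]
  generalize comul (R := k) f = t
  induction t using TensorProduct.induction_on with
  | zero => simp
  | tmul p q =>
    simp only [TensorProduct.map_tmul, LinearMap.mul'_apply, LinearMap.id_apply,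
      TensorProduct.lift.tmul]
    have h (v) : Gam T n v = T (sol k n v) := rfl
    have h₁ : Gam T 1 q = T (sol₁ k q) := by rw [Gam, sol_one]; rfl
    rw [hT.map_mul_of_primitive _ (comul_sol₁ q), h₁, h, h]
    -- Equivariance turns `sol n p ◁◁ b` into `sol n (p ◁◁ b)`, so that `T ∘ sol n` reappears as
    -- `Γₙ`.
    exact congrArg (fun v => T (sol k n p) * T (sol₁ k q) - T v) (M.sol_envAct n p _).symm
  | add s t hs ht =>
    simp only [map_add, hs, ht]
    abel

theorem Gam_eq_hashPow (hT : M.envelope.IsOHopfOperator T) (n : ℕ) :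
    Gam T n = (n.factorial : k)⁻¹ • M.envelope.hashPow (Gam T 1) n := by
  induction n with
  | zero => simp [Gam_zero hT, RightHopfModule.hashPow]
  | succ n ih =>
    refine LinearMap.ext fun f => ?_
    rw [Gam_succ hT, LinearMap.smul_apply, RightHopfModule.hashPow,
      M.envelope.hash_apply_of_primitive _ _ (comul_Gam_one hT), ih, WithConv.toConv_smul,
      smul_mul_assoc, WithConv.ofConv_smul, LinearMap.smul_apply, LinearMap.smul_apply,
      ← smul_sub, smul_smul, Nat.factorial_succ]
    push_cast
    rw [mul_inv]

/-- The counit axioms collapse the right side of the cococycle condition to `1 ⊗ Γ₁ f + Γ₁ f ⊗ 1`,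
so the condition says that the values are primitive. -/
theorem isCococycle_Gam_one (hT : M.envelope.IsOHopfOperator T) :
    RightHopfModule.IsCococycle (Gam T 1) := by
  refine LinearMap.ext fun f => ?_
  have h₁ (F : UniversalEnvelopingAlgebra k 𝔤 →ₗ[k] UniversalEnvelopingAlgebra k 𝔞) :
      TensorProduct.map (Algebra.linearMap k (UniversalEnvelopingAlgebra k 𝔞) ∘ₗ counit) F
        (comul (R := k) f) = 1 ⊗ₜ[k] F f := by
    have h := congrArg (TensorProduct.map (Algebra.linearMap k (UniversalEnvelopingAlgebra k 𝔞)) F)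
      (rTensor_counit_comul (R := k) f)
    rw [← LinearMap.comp_apply, LinearMap.map_comp_rTensor] at h
    simpa using h
  have h₂ (F : UniversalEnvelopingAlgebra k 𝔤 →ₗ[k] UniversalEnvelopingAlgebra k 𝔞) :
      TensorProduct.map F (Algebra.linearMap k (UniversalEnvelopingAlgebra k 𝔞) ∘ₗ counit)
        (comul (R := k) f) = F f ⊗ₜ[k] 1 := by
    have h := congrArg (TensorProduct.map F (Algebra.linearMap k (UniversalEnvelopingAlgebra k 𝔞)))
      (lTensor_counit_comul (R := k) f)
    rw [← LinearMap.comp_apply, LinearMap.map_comp_lTensor] at h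
    simpa using h
  simp only [LinearMap.comp_apply, LinearMap.add_apply, h₁, h₂, comul_Gam_one hT]
  exact add_comm _ _

end Gam

theorem mainTheorem7 {k 𝔤 𝔞 : Type*} [Field k] [CharZero k]
    [LieRing 𝔤] [LieAlgebra k 𝔤] [LieRing 𝔞] [LieAlgebra k 𝔞]
    (M : RightLieModule k 𝔤 𝔞)
    (T : UniversalEnvelopingAlgebra k 𝔤 →ₗc[k] UniversalEnvelopingAlgebra k 𝔞)
    (hT : M.envelope.IsOHopfOperator T) :
    -- the recursion, with `*` the convolution product
    (∀ n : ℕ, 1 ≤ n → ∀ f : UniversalEnvelopingAlgebra k 𝔤,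
      Gam T (n + 1) f = ((n : k) + 1)⁻¹ •
        ((toConv (Gam T n) * toConv (Gam T 1)).ofConv f -
          Gam T n (M.envelope.idAct (Gam T 1) f))) ∧
    -- the closed form
    (∀ n : ℕ, 1 ≤ n → Gam T n = (n.factorial : k)⁻¹ • M.envelope.hashPow (Gam T 1) n) ∧
    -- `T ∘ sol₁` is in the domain of the exponential, whose series is finite on every element
    RightHopfModule.IsCococycle (Gam T 1) ∧
    (∀ f, ∃ N, ∀ n, N ≤ n → M.envelope.hashPow (Gam T 1) n f = 0) ∧
    (∀ f, T f = M.envelope.expHash (Gam T 1) f) := by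
  have hpow (n : ℕ) (f) : (n.factorial : k)⁻¹ • M.envelope.hashPow (Gam T 1) n f =
      T (UniversalEnvelopingAlgebra.sol k n f) := congr($((Gam_eq_hashPow hT n).symm) f)
  refine ⟨fun n _ => Gam_succ hT n, fun n _ => Gam_eq_hashPow hT n, isCococycle_Gam_one hT,
    fun f => ?_, fun f => ?_⟩
  · obtain ⟨N, hN, -⟩ := UniversalEnvelopingAlgebra.exists_sol_eq_zero f
    refine ⟨N, fun n hn => ?_⟩
    have h := hpow n f
    rw [hN n hn, map_zero] at h
    -- The closed form controls `Γ₁^{# n}` only up to `1 / n!`, which is nonzero in characteristic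
    -- zero.
    exact (smul_eq_zero.1 h).resolve_left
      (inv_ne_zero (Nat.cast_ne_zero.2 (Nat.factorial_ne_zero n)))
  · obtain ⟨N, hN, hsum⟩ := UniversalEnvelopingAlgebra.exists_sol_eq_zero f
    simp only [RightHopfModule.expHash, hpow]
    rw [finsum_eq_sum_of_support_subset (s := Finset.range N), ← map_sum, hsum]
    intro n hn
    by_contra h
    exact hn (by simp only [hN n (by simpa using h), map_zero])

end
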